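/- **Model.** A team of $N$ agents has a state space $\mathcal S$ (a measurable space, e.g. a topological space with its Borel $\sigma$-algebra), a finite joint-observation space $\mathcal O=\mathcal O^0\times\mathcal O^1\times\dots\times\mathcal O^N$ ($\mathcal O^0$: observations common to all agents; $\mathcal O^n$: private observations of agent $n$) and a finite joint-action space $\mathcal A=\mathcal A^1\times\dots\times\mathcal A^N$; the finite sets are discrete. Let $P_1$ be a probability measure on $\mathcal S\times\mathcal O$ and $P_{tr}$ a transition kernel from $\mathcal S\times\mathcal A$ to $\mathcal S\times\mathcal O$. At time $1$, $(S_1,O_1)\sim P_1$; at each time $t$ a joint action $A_t\in\mathcal A$ is taken, and, given the whole past, $(S_{t+1},O_{t+1})\sim P_{tr}(\cdot\mid S_t,A_t)$. Write $H_t=(O_{1:t},A_{1:t-1})$ for the joint history at time $t$, with set of values $\mathcal H_t=\mathcal O^t\times\mathcal A^{t-1}$, $H^0_t=O^0_{1:t}$ for the common history and $H^n_t=(O^n_{1:t},A^n_{1:t-1})$, with set of values $\mathcal H^n_t$, for the private history of agent $n$. For a finite set $E$, $\mathcal M_1(E)$ is the set of probability distributions on $E$; for an infinite policy space $X$ (below),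 a product of countably many such simplices with the product topology or a closed subset of one, $\mathcal M_1(X)$ is the set of Borel probability measures on $X$. **Decentralized policies.** A behavioral policy-profile $u\in\mathcal U$ consists of maps $u^n_t:(\mathcal O^0)^t\times\mathcal H^n_t\to\mathcal M_1(\mathcal A^n)$ for all $n$ and $t$; under $u$, given the past, the actions $A^n_t\sim u^n_t(H^0_t,H^n_t)$ are drawn independently over $n$. $\mathcal U_{\mathrm{pure}}\subseteq\mathcal U$ is the set of the profiles all of whose values are Dirac measures. **Coordination policies.** Let $\mathcal G_t$ be the (finite) set of prescriptions $\gamma=(\gamma^1,\dots,\gamma^N)$, $\gamma^n:\mathcal H^n_t\to\mathcal A^n$. A behavioral coordination policy $v\in\mathcal V$ consists of maps $v_t:(\mathcal O^0)^t\times\mathcal G_1\times\dots\times\mathcal G_{t-1}\to\mathcal M_1(\mathcal G_t)$ for all $t$; under $v$, given the past, a prescription $\Gamma_t\sim v_t(H^0_t,\Gamma_{1:t-1})$ is drawn, and $A^n_t=\Gamma^n_t(H^n_t)$ for each $n$. $\mathcal V_{\mathrm{pure}}\subseteq\mathcal V$ is the set of the policies all of whose values are Dirac measures. **Mixtures and occupation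 measures.** Each $x\in\mathcal U$ or $x\in\mathcal V$ determines a unique trajectory law $\mathbb P^x$ (Ionescu-Tulcea). An element $\mu$ of $\mathcal M_1(\mathcal U)$ or $\mathcal M_1(\mathcal V)$ is a mixture: a policy is drawn from $\mu$ before time $1$ and is then used throughout; $\mathbb P^\mu$ denotes the resulting law. $\mathcal M_1(\mathcal U_{\mathrm{pure}})$ and $\mathcal M_1(\mathcal V_{\mathrm{pure}})$ are regarded as subsets of $\mathcal M_1(\mathcal U)$ and $\mathcal M_1(\mathcal V)$. The undiscounted occupation measure of $x$ is the family $$\Lambda(x)=\bigl(\mathbb P^x(H_t=h,\ A_t=a)\bigr)_{t\ge1,\ h\in\mathcal H_t,\ a\in\mathcal A},$$ and $\Lambda(X)=\{\Lambda(x):x\in X\}$. **Theorem.** Under these assumptions (in particular, $\mathcal O$ is finite), $$\Lambda\bigl(\mathcal M_1(\mathcal U_{\mathrm{pure}})\bigr)=\Lambda\bigl(\mathcal M_1(\mathcal V_{\mathrm{pure}})\bigr).$$ Moreover the sets of occupation measures of all five classes coincide: $$\Lambda\bigl(\mathcal M_1(\mathcal U)\bigr)=\Lambda\bigl(\mathcal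 M_1(\mathcal U_{\mathrm{pure}})\bigr)=\Lambda(\mathcal V)=\Lambda\bigl(\mathcal M_1(\mathcal V)\bigr)=\Lambda\bigl(\mathcal M_1(\mathcal V_{\mathrm{pure}})\bigr).$$ -/

import Mathlib

open MeasureTheory ProbabilityTheory Finset Preorder
open scoped ENNReal

noncomputable section

namespace Team

/-! ## Trajectories of a controlled, partially observed process

Time-steps are numbered from `0`.  At time `t` the pair (state, observation) in `S × Z` is generated,
then a decision in `D t` is taken, and `act t` extracts the (joint) action in `B` from that decision.
The decision depends on a policy `p : P` and on the past and current observations and the past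
decisions. -/

section Trajectories

variable {S Z B P : Type*} {D : ℕ → Type*}

/-- Observations up to and including time `t`, together with the decisions before time `t`. -/
abbrev History (Z : Type*) (D : ℕ → Type*) (t : ℕ) : Type _ :=
  (Fin (t + 1) → Z) × (∀ i : Fin t, D i)

/-- State, observation and decision at time `t`. -/
abbrev Stage (S Z : Type*) (D : ℕ → Type*) (t : ℕ) : Type _ := (S × Z) × D t

/-- The history at time `0`, given the first observation. -/
def firstHistory (z : Z) : History Z D 0 := (fun _ => z, fun i => i.elim0)

/-- The history at time `t + 1`, given the stages up to time `t` and the new observation. -/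
def nextHistory (t : ℕ) (x : ∀ i : Iic t, Stage S Z D i) (z : Z) : History Z D (t + 1) :=
  (Fin.snoc (α := fun _ => Z)
      (fun i : Fin (t + 1) => (x ⟨i, mem_Iic.2 (Nat.le_of_lt_succ i.2)⟩).1.2) z,
    fun i => (x ⟨i, mem_Iic.2 (Nat.le_of_lt_succ i.2)⟩).2)

variable [MeasurableSpace S] [MeasurableSpace Z] [MeasurableSpace B] [MeasurableSpace P]
  [∀ t, MeasurableSpace (D t)]

theorem measurable_firstHistory : Measurable (firstHistory : Z → History Z D 0) := by
  unfold firstHistory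
  fun_prop

theorem measurable_nextHistory (t : ℕ) :
    Measurable fun q : (∀ i : Iic t, Stage S Z D i) × Z => nextHistory t q.1 q.2 := by
  unfold nextHistory
  refine Measurable.prodMk (measurable_pi_lambda _ fun i => ?_) (by fun_prop)
  induction i using Fin.lastCases with
  | last => simp only [Fin.snoc_last]; fun_prop
  | cast i => simp only [Fin.snoc_castSucc]; fun_prop

variable [∀ t, DiscreteMeasurableSpace (D t)]

/-- The law of the stage at time `0`: state and observation are drawn from `P₁`, and then the
decision from the rule `ctrl 0` of the policy. -/
def initialKernel (P₁ : Measure (S × Z)) (ctrl : ∀ t, Kernel (P × History Z D t) (D t)) :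
    Kernel P (Stage S Z D 0) :=
  Kernel.const P P₁ ⊗ₖ
    (ctrl 0).comap (fun q : P × (S × Z) => (q.1, firstHistory q.2.2))
      (measurable_fst.prodMk (measurable_firstHistory.comp (by fun_prop)))

/-- The conditional law of the stage at time `t + 1` given the policy and all stages up to time `t`:
the new state and observation are drawn from the transition law at the last state and last action,
and then the decision from the rule `ctrl (t + 1)` of the policy. -/
def stepKernel (Ptr : Kernel (S × B) (S × Z)) (act : ∀ t, D t → B)
    (ctrl : ∀ t, Kernel (P × History Z D t) (D t)) (t : ℕ) :
    Kernel (P × (∀ i : Iic t, Stage S Z D i)) (Stage S Z D (t + 1)) :=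
  (Ptr.comap (fun q : P × (∀ i : Iic t, Stage S Z D i) =>
      ((q.2 ⟨t, mem_Iic.2 le_rfl⟩).1.1, act t (q.2 ⟨t, mem_Iic.2 le_rfl⟩).2))
      (Measurable.prodMk (by fun_prop)
        ((Measurable.of_discrete (f := act t)).comp (by fun_prop)))) ⊗ₖ
    (ctrl (t + 1)).comap
      (fun q : (P × (∀ i : Iic t, Stage S Z D i)) × (S × Z) =>
        (q.1.1, nextHistory t q.1.2 q.2.2))
      (Measurable.prodMk (by fun_prop)
        ((measurable_nextHistory t).comp
          (f := fun q : (P × (∀ i : Iic t, Stage S Z D i)) × (S × Z) => (q.1.2, q.2.2))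
          (by fun_prop)))

instance (P₁ : Measure (S × Z)) [IsProbabilityMeasure P₁]
    (ctrl : ∀ t, Kernel (P × History Z D t) (D t)) [∀ t, IsMarkovKernel (ctrl t)] :
    IsMarkovKernel (initialKernel P₁ ctrl) := by
  unfold initialKernel; infer_instance

instance (Ptr : Kernel (S × B) (S × Z)) [IsMarkovKernel Ptr] (act : ∀ t, D t → B)
    (ctrl : ∀ t, Kernel (P × History Z D t) (D t)) [∀ t, IsMarkovKernel (ctrl t)] (t : ℕ) :
    IsMarkovKernel (stepKernel Ptr act ctrl t) := by
  unfold stepKernel; infer_instance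

end Trajectories

section Measurability

variable {P : Type*} [MeasurableSpace P] {X : ℕ → Type*} [∀ t, MeasurableSpace (X t)]

/-- Ionescu-Tulcea measures depend measurably on a parameter. -/
theorem measurable_trajMeasure (κ₀ : Kernel P (X 0)) [IsMarkovKernel κ₀]
    (κ : ∀ t, Kernel (P × (∀ i : Iic t, X i)) (X (t + 1))) [∀ t, IsMarkovKernel (κ t)] :
    Measurable fun p => Kernel.trajMeasure (κ₀ p) fun t => (κ t).sectR p := by
  have key : ∀ n, Measurable fun p =>
      (Kernel.trajMeasure (κ₀ p) fun t => (κ t).sectR p).map (frestrictLe n) := by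
    intro n
    induction n with
    | zero =>
      have h : ∀ p, (Kernel.trajMeasure (κ₀ p) fun t => (κ t).sectR p).map (frestrictLe 0)
          = (κ₀ p).map (MeasurableEquiv.piUnique (fun i : Iic 0 => X i)).symm := by
        intro p
        rw [Kernel.trajMeasure, Measure.map_comp _ _ (by fun_prop),
          Kernel.traj_map_frestrictLe, Kernel.partialTraj_self, Measure.id_comp]
        rfl
      simp_rw [h]
      exact (Measure.measurable_map _ (MeasurableEquiv.measurable _)).comp κ₀.measurable
    | succ n ih =>
      let M : Kernel P (∀ i : Iic n, X i) := ⟨_, ih⟩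
      have hM : IsMarkovKernel M := ⟨fun p => Measure.isProbabilityMeasure_map (by fun_prop)⟩
      let g : (∀ i : Iic n, X i) × X (n + 1) → (∀ i : Iic (n + 1), X i) := fun q =>
        IicProdIoc n (n + 1) (q.1, MeasurableEquiv.piSingleton n q.2)
      have hg : Measurable g := by fun_prop
      have h : ∀ p, (Kernel.trajMeasure (κ₀ p) fun t => (κ t).sectR p).map (frestrictLe (n + 1))
          = ((M ⊗ₖ κ n) p).map g := by
        intro p
        have h1 : (M ⊗ₖ κ n) p = (M p) ⊗ₘ ((κ n).sectR p) := by
          ext s hs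
          rw [Kernel.compProd_apply hs, Measure.compProd_apply hs]
          rfl
        have h2 := Kernel.map_frestrictLe_trajMeasure_compProd_eq_map_trajMeasure
          (μ₀ := κ₀ p) (κ := fun t => (κ t).sectR p) (a := n)
        rw [h1]
        change _ = (((Kernel.trajMeasure (κ₀ p) fun t => (κ t).sectR p).map (frestrictLe n)) ⊗ₘ
          ((κ n).sectR p)).map g
        rw [h2, Measure.map_map hg (by fun_prop)]
        congr 1
        ext x i
        by_cases hi : (i : ℕ) ≤ n
        · simp [g, IicProdIoc, hi]
        · obtain ⟨i, hi'⟩ := i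
          obtain rfl : i = n + 1 := by
            have := mem_Iic.1 hi'
            simp only at hi
            omega
          simp [g, IicProdIoc, MeasurableEquiv.piSingleton]
      simp_rw [h]
      exact (Measure.measurable_map _ hg).comp (M ⊗ₖ κ n).measurable
  refine Measurable.measure_of_isPiSystem_of_isProbabilityMeasure
    generateFrom_measurableCylinders.symm isPiSystem_measurableCylinders ?_
  intro s hs
  obtain ⟨N, T, hT, rfl⟩ := (mem_measurableCylinders s).1 hs
  have hsub : N ⊆ Iic (N.sup id) := fun i hi => mem_Iic.2 (Finset.le_sup (f := id) hi)
  have hpre : cylinder N T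
      = (frestrictLe (π := X) (N.sup id)) ⁻¹' ((restrict₂ (π := X) hsub) ⁻¹' T) := rfl
  have hT' : MeasurableSet ((restrict₂ (π := X) hsub) ⁻¹' T) := (by fun_prop : Measurable _) hT
  have h := (Measure.measurable_coe hT').comp (key (N.sup id))
  convert h using 2 with p
  simp only [Function.comp_apply]
  rw [Measure.map_apply (by fun_prop) hT', hpre]

end Measurability

section Law

variable {S Z B P : Type*} {D : ℕ → Type*} [MeasurableSpace S] [MeasurableSpace Z]
  [MeasurableSpace B] [MeasurableSpace P] [∀ t, MeasurableSpace (D t)]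
  [∀ t, DiscreteMeasurableSpace (D t)]

/-- For a policy `p`, the (Ionescu-Tulcea) law of the trajectory of all states, observations and
decisions when `p` is used. -/
def trajLaw (P₁ : Measure (S × Z)) [IsProbabilityMeasure P₁]
    (Ptr : Kernel (S × B) (S × Z)) [IsMarkovKernel Ptr] (act : ∀ t, D t → B)
    (ctrl : ∀ t, Kernel (P × History Z D t) (D t)) [∀ t, IsMarkovKernel (ctrl t)] :
    Kernel P (∀ t, Stage S Z D t) where
  toFun p := Kernel.trajMeasure (initialKernel P₁ ctrl p)
    fun t => (stepKernel Ptr act ctrl t).sectR p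
  measurable' := measurable_trajMeasure _ _

/-- The joint history (observations up to time `t`, actions before time `t`) of a trajectory. -/
def jointHistory (act : ∀ t, D t → B) (t : ℕ) (ω : ∀ t, Stage S Z D t) :
    (Fin (t + 1) → Z) × (Fin t → B) :=
  (fun i => (ω i).1.2, fun i => act i (ω i).2)

/-- The joint action at time `t` of a trajectory. -/
def jointAction (act : ∀ t, D t → B) (t : ℕ) (ω : ∀ t, Stage S Z D t) : B := act t (ω t).2

/-- The undiscounted infinite-horizon occupation measure of a trajectory law: the family of the
probabilities of all pairs (joint history at time `t`, joint action at time `t`), for all `t`. -/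
def occupation (act : ∀ t, D t → B) (m : Measure (∀ t, Stage S Z D t)) :
    ∀ t, (Fin (t + 1) → Z) × (Fin t → B) → B → ℝ≥0∞ :=
  fun t h a => m {ω | jointHistory act t ω = h ∧ jointAction act t ω = a}

/-- The joint law of the policy and of the trajectory when, before time `0`, the policy is drawn
from `μ` and is then used. -/
def mixtureLaw (law : Kernel P (∀ t, Stage S Z D t)) (μ : ProbabilityMeasure P) :
    Measure (P × (∀ t, Stage S Z D t)) :=
  (μ : Measure P) ⊗ₘ law

/-- The occupation measure generated by the mixture `μ` of policies. -/
def mixtureOccupation (act : ∀ t, D t → B) (law : Kernel P (∀ t, Stage S Z D t))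
    (μ : ProbabilityMeasure P) : ∀ t, (Fin (t + 1) → Z) × (Fin t → B) → B → ℝ≥0∞ :=
  occupation act ((mixtureLaw law μ).map Prod.snd)

end Law

/-! ## Teams -/

section Teams

variable {N : ℕ}

/-- Joint observations: the common one and the private ones of the agents. -/
abbrev JointObs {N : ℕ} (O₀ : Type*) (O : Fin N → Type*) : Type _ := O₀ × (∀ n, O n)

/-- Joint actions. -/
abbrev JointAct {N : ℕ} (A : Fin N → Type*) : Type _ := ∀ n, A n

/-- Common histories at time `t`. -/
abbrev CommonHist (O₀ : Type*) (t : ℕ) : Type _ := Fin (t + 1) → O₀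

/-- Private histories of agent `n` at time `t`: private observations up to time `t` and own actions
before time `t`. -/
abbrev PrivateHist {N : ℕ} (O A : Fin N → Type*) (n : Fin N) (t : ℕ) : Type _ :=
  (Fin (t + 1) → O n) × (Fin t → A n)

/-- The common part of an observation sequence. -/
def commonHist {O₀ : Type*} {O : Fin N → Type*} {t : ℕ} (o : Fin (t + 1) → JointObs O₀ O) :
    CommonHist O₀ t := fun i => (o i).1

/-- Agent `n`'s private part of an observation sequence and an action sequence. -/
def privateHist {O₀ : Type*} {O A : Fin N → Type*} {t : ℕ} (o : Fin (t + 1) → JointObs O₀ O)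
    (a : Fin t → JointAct A) (n : Fin N) : PrivateHist O A n t :=
  (fun i => (o i).2 n, fun i => a i n)

/-- Decentralized behavioral policy-profiles: for each agent and time, a distribution on the agent's
actions for each common history and private history of the agent.  The `σ`-algebra is the product of
the `σ`-algebras generated by the evaluations `p ↦ p E`; for finite action sets and countably many
histories it is the Borel `σ`-algebra of the product of the weak topologies. -/
abbrev DecPolicy {N : ℕ} (O₀ : Type*) (O A : Fin N → Type*) [∀ n, MeasurableSpace (A n)] : Type _ :=
  ∀ (n : Fin N) (t : ℕ), CommonHist O₀ t × PrivateHist O A n t → ProbabilityMeasure (A n)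

/-- Pure decentralized policy-profiles: every decision rule is deterministic. -/
def pureDecPolicies {N : ℕ} (O₀ : Type*) (O A : Fin N → Type*) [∀ n, MeasurableSpace (A n)] :
    Set (DecPolicy O₀ O A) :=
  {u | ∀ n t h, ∃ a, (u n t h : Measure (A n)) = Measure.dirac a}

/-- Prescriptions at time `t`: for each agent, a map from private histories to actions. -/
abbrev Prescription {N : ℕ} (O A : Fin N → Type*) (t : ℕ) : Type _ :=
  ∀ n : Fin N, PrivateHist O A n t → A n

/-- Prescription-observation histories of the coordinator at time `t`: common observations up to time
`t` and prescriptions before time `t`. -/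
abbrev CoordHist {N : ℕ} (O₀ : Type*) (O A : Fin N → Type*) (t : ℕ) : Type _ :=
  CommonHist O₀ t × (∀ i : Fin t, Prescription O A i)

/-- Behavioral coordination policies. -/
abbrev CoordPolicy {N : ℕ} (O₀ : Type*) (O A : Fin N → Type*) [∀ n, MeasurableSpace (A n)] :
    Type _ :=
  ∀ t : ℕ, CoordHist O₀ O A t → ProbabilityMeasure (Prescription O A t)

/-- Pure coordination policies. -/
def pureCoordPolicies {N : ℕ} (O₀ : Type*) (O A : Fin N → Type*) [∀ n, MeasurableSpace (A n)] :
    Set (CoordPolicy O₀ O A) :=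
  {v | ∀ t h, ∃ γ, (v t h : Measure (Prescription O A t)) = Measure.dirac γ}

variable {O₀ : Type*} {O A : Fin N → Type*}
  [Finite O₀] [∀ n, Finite (O n)] [∀ n, Finite (A n)]
  [MeasurableSpace O₀] [∀ n, MeasurableSpace (O n)] [∀ n, MeasurableSpace (A n)]
  [MeasurableSingletonClass O₀] [∀ n, MeasurableSingletonClass (O n)]
  [∀ n, MeasurableSingletonClass (A n)]

/-- In the decentralized system the decision is the joint action. -/
abbrev DecDecision {N : ℕ} (A : Fin N → Type*) (_ : ℕ) : Type _ := JointAct A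

/-- In the coordinated system the decision consists of the prescription and the joint action. -/
abbrev CoordDecision {N : ℕ} (O A : Fin N → Type*) (t : ℕ) : Type _ :=
  Prescription O A t × JointAct A

/-- The joint action in a decision of the decentralized system. -/
def decAct (A : Fin N → Type*) (t : ℕ) : DecDecision A t → JointAct A := id

/-- The joint action in a decision of the coordinated system. -/
def coordAct (O A : Fin N → Type*) (t : ℕ) : CoordDecision O A t → JointAct A := Prod.snd

variable (O₀ O A) in
/-- Under a decentralized policy-profile the agents draw their actions independently, each from the
decision rule evaluated at the common history and the agent's private history. -/
def decControl (t : ℕ) :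
    Kernel (DecPolicy O₀ O A × History (JointObs O₀ O) (DecDecision A) t) (DecDecision A t) where
  toFun q := Measure.pi fun n =>
    (q.1 n t (commonHist q.2.1, privateHist q.2.1 q.2.2 n) : Measure (A n))
  measurable' := by
    refine measurable_from_prod_countable_left fun h => ?_
    refine Measure.measurable_of_measurable_coe _ fun s _ => ?_
    have hs : ∀ μ : Measure (JointAct A), μ s = ∑' a : s, μ {(a : JointAct A)} := fun μ => by
      have h := measure_biUnion (μ := μ) (f := fun a => {a}) s.to_countable
        (fun a _ b _ hab => by simpa using hab) fun _ _ => measurableSet_singleton _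
      rwa [Set.biUnion_of_singleton] at h
    simp_rw [hs, Measure.pi_singleton]
    refine Measurable.tsum fun a => Finset.measurable_prod _ fun n _ => ?_
    exact (Measure.measurable_coe (measurableSet_singleton _)).comp
      (measurable_subtype_coe.comp (by fun_prop))

instance (t : ℕ) : IsMarkovKernel (decControl O₀ O A t) :=
  ⟨fun _ => inferInstanceAs (IsProbabilityMeasure (Measure.pi _))⟩

variable (O₀ O A) in
/-- Under a coordination policy the prescription is drawn from the policy's rule at the
prescription-observation history, and each agent applies her component to her private history. -/
def coordControl (t : ℕ) :
    Kernel (CoordPolicy O₀ O A × History (JointObs O₀ O) (CoordDecision O A) t)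
      (CoordDecision O A t) where
  toFun q := (q.1 t (commonHist q.2.1, fun i => (q.2.2 i).1) : Measure (Prescription O A t)).map
    fun γ => (γ, fun n => γ n (privateHist q.2.1 (fun i => (q.2.2 i).2) n))
  measurable' := by
    refine measurable_from_prod_countable_left fun h => ?_
    have hv : Measurable fun v : CoordPolicy O₀ O A =>
        v t (commonHist h.1, fun i => (h.2 i).1) :=
      (measurable_pi_apply _).comp (measurable_pi_apply t)
    have hγ : Measurable fun γ : Prescription O A t =>
        ((γ, fun n => γ n (privateHist h.1 (fun i => (h.2 i).2) n)) : CoordDecision O A t) :=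
      measurable_of_finite _
    exact (Measure.measurable_map _ hγ).comp (measurable_subtype_coe.comp hv)

instance (t : ℕ) : IsMarkovKernel (coordControl O₀ O A t) :=
  ⟨fun _ => Measure.isProbabilityMeasure_map (measurable_of_finite _).aemeasurable⟩

variable {S : Type*} [MeasurableSpace S]

/-- Trajectory laws of the decentralized policy-profiles. -/
def decLaw (P₁ : Measure (S × JointObs O₀ O)) [IsProbabilityMeasure P₁]
    (Ptr : Kernel (S × JointAct A) (S × JointObs O₀ O)) [IsMarkovKernel Ptr] :
    Kernel (DecPolicy O₀ O A) (∀ t, Stage S (JointObs O₀ O) (DecDecision A) t) :=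
  trajLaw P₁ Ptr (decAct A) (decControl O₀ O A)

/-- Trajectory laws of the coordination policies. -/
def coordLaw (P₁ : Measure (S × JointObs O₀ O)) [IsProbabilityMeasure P₁]
    (Ptr : Kernel (S × JointAct A) (S × JointObs O₀ O)) [IsMarkovKernel Ptr] :
    Kernel (CoordPolicy O₀ O A) (∀ t, Stage S (JointObs O₀ O) (CoordDecision O A) t) :=
  trajLaw P₁ Ptr (coordAct O A) (coordControl O₀ O A)

/-- Families of numbers indexed by the pairs (joint history, joint action) of all times. -/
abbrev OccupationFamily {N : ℕ} (O₀ : Type*) (O A : Fin N → Type*) : Type _ :=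
  ∀ t : ℕ, (Fin (t + 1) → JointObs O₀ O) × (Fin t → JointAct A) → JointAct A → ℝ≥0∞

/-- Occupation measures of joint mixtures of decentralized behavioral policy-profiles. -/
def occMixDec (P₁ : Measure (S × JointObs O₀ O)) [IsProbabilityMeasure P₁]
    (Ptr : Kernel (S × JointAct A) (S × JointObs O₀ O)) [IsMarkovKernel Ptr] :
    Set (OccupationFamily O₀ O A) :=
  Set.range fun μ : ProbabilityMeasure (DecPolicy O₀ O A) =>
    mixtureOccupation (decAct A) (decLaw P₁ Ptr) μ

/-- Occupation measures of joint mixtures of decentralized pure policy-profiles. -/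
def occMixPureDec (P₁ : Measure (S × JointObs O₀ O)) [IsProbabilityMeasure P₁]
    (Ptr : Kernel (S × JointAct A) (S × JointObs O₀ O)) [IsMarkovKernel Ptr] :
    Set (OccupationFamily O₀ O A) :=
  Set.range fun μ : ProbabilityMeasure (pureDecPolicies O₀ O A) =>
    mixtureOccupation (decAct A) (decLaw P₁ Ptr) (μ.map measurable_subtype_coe.aemeasurable)

/-- Occupation measures of behavioral coordination policies. -/
def occCoord (P₁ : Measure (S × JointObs O₀ O)) [IsProbabilityMeasure P₁]
    (Ptr : Kernel (S × JointAct A) (S × JointObs O₀ O)) [IsMarkovKernel Ptr] :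
    Set (OccupationFamily O₀ O A) :=
  Set.range fun v : CoordPolicy O₀ O A => occupation (coordAct O A) (coordLaw P₁ Ptr v)

/-- Occupation measures of mixtures of behavioral coordination policies. -/
def occMixCoord (P₁ : Measure (S × JointObs O₀ O)) [IsProbabilityMeasure P₁]
    (Ptr : Kernel (S × JointAct A) (S × JointObs O₀ O)) [IsMarkovKernel Ptr] :
    Set (OccupationFamily O₀ O A) :=
  Set.range fun ν : ProbabilityMeasure (CoordPolicy O₀ O A) =>
    mixtureOccupation (coordAct O A) (coordLaw P₁ Ptr) ν

/-- Occupation measures of mixtures of pure coordination policies. -/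
def occMixPureCoord (P₁ : Measure (S × JointObs O₀ O)) [IsProbabilityMeasure P₁]
    (Ptr : Kernel (S × JointAct A) (S × JointObs O₀ O)) [IsMarkovKernel Ptr] :
    Set (OccupationFamily O₀ O A) :=
  Set.range fun ν : ProbabilityMeasure (pureCoordPolicies O₀ O A) =>
    mixtureOccupation (coordAct O A) (coordLaw P₁ Ptr) (ν.map measurable_subtype_coe.aemeasurable)

end Teams

end Team

end

noncomputable section

namespace Team

/-! This is a Kuhn-type equivalence between mixing and randomizing along the way, combined with the
observation that a coordinator who sees only common information can be simulated by every agent.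

Each entry of an occupation measure is the probability of a path event, and such a probability
splits into a product of decision probabilities and a factor `envMeasure` that does not depend on
the policy (`trajLaw_pathEvent`). For a coordination policy `v` the event is first split according
to the finitely many sequences of prescriptions; each piece is then `drawProb k γ t v` times a
number free of `v`. Hence a mixture over coordination policies enters only through the expectations
of `drawProb` (`mixtureOccupation_coord_congr`).

Four constructions then suffice. A decentralized profile becomes a coordination policy by drawing
actions for all private histories independently (`coordOfDec`). A mixture becomes a single
behavioral policy by conditioning on the prescriptions drawn so far (`condPolicy`): the conditional
probabilities telescope to the expected `drawProb`. A behavioral policy becomes a mixture of pure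
ones by drawing the prescriptions for all histories in advance, independently (`ruleLaw`); the
coordinator remembers everything, so no coordinate is used twice. Finally, under a pure coordination
policy the prescriptions are a function of the common history, so each agent can compute her own
component (`CoordRule.unfold`, `occupation_toDec`). Applied to the same random rule, this turns the
pure coordination mixture into a pure decentralized one. -/

/-- Up to time `t` the observations are `z` and the decisions lie in the sets `G`. -/
def pathEvent {S Z : Type*} {D : ℕ → Type*} (z : ℕ → Z) (G : ∀ s, Set (D s)) (t : ℕ) :
    Set (∀ t, Stage S Z D t) :=
  {ω | ∀ s ≤ t, (ω s).1.2 = z s ∧ (ω s).2 ∈ G s}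

/-- Every joint history and joint action is a prefix of an infinite sequence. -/
theorem exists_eq_prefix {Z B : Type*} (t : ℕ) (h : (Fin (t + 1) → Z) × (Fin t → B)) (a : B) :
    ∃ (z : ℕ → Z) (b : ℕ → B), h = (fun i : Fin (t + 1) => z i, fun i : Fin t => b i) ∧ a = b t := by
  -- The default `a` for actions makes `b t = a`; the observations after time `t` play no role.
  refine ⟨fun s => if hs : s < t + 1 then h.1 ⟨s, hs⟩ else h.1 0,
    fun s => if hs : s < t then h.2 ⟨s, hs⟩ else a, ?_, by simp⟩
  ext i
  · change _ = dite _ _ _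
    rw [dif_pos i.2]
  · simp

/-- Occupation measures are the probabilities of path events. -/
theorem occupation_prefix {S Z B : Type*} {D : ℕ → Type*}
    [MeasurableSpace S] [MeasurableSpace Z] [∀ t, MeasurableSpace (D t)] (act : ∀ t, D t → B)
    (m : Measure (∀ t, Stage S Z D t)) (z : ℕ → Z) (b : ℕ → B) (t : ℕ) :
    occupation act m t (fun i : Fin (t + 1) => z i, fun i : Fin t => b i) (b t)
      = m (pathEvent z (fun s => act s ⁻¹' {b s}) t) := by
  unfold occupation
  congr 1
  ext ω
  simp only [jointHistory, jointAction, pathEvent, Set.mem_ofPred_eq, Set.mem_preimage,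
    Set.mem_singleton_iff, Prod.mk.injEq, funext_iff]
  constructor
  · rintro ⟨⟨h1, h2⟩, h3⟩ s hs
    refine ⟨h1 ⟨s, Nat.lt_succ_of_le hs⟩, ?_⟩
    rcases hs.lt_or_eq with hst | rfl
    · exact h2 ⟨s, hst⟩
    · exact h3
  · exact fun H => ⟨⟨fun i => (H i (Nat.le_of_lt_succ i.2)).1, fun i => (H i i.2.le).2⟩,
      (H t le_rfl).2⟩

/-! ### Factorization of path probabilities into policy and environment. -/

section Factorization

variable {S Z B P : Type*} {D : ℕ → Type*} [MeasurableSpace S] [MeasurableSpace Z]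
  [MeasurableSpace B] [MeasurableSpace P] [∀ t, MeasurableSpace (D t)]
  [∀ t, DiscreteMeasurableSpace (D t)]

instance (P₁ : Measure (S × Z)) [IsProbabilityMeasure P₁]
    (Ptr : Kernel (S × B) (S × Z)) [IsMarkovKernel Ptr] (act : ∀ t, D t → B)
    (ctrl : ∀ t, Kernel (P × History Z D t) (D t)) [∀ t, IsMarkovKernel (ctrl t)] :
    IsMarkovKernel (trajLaw P₁ Ptr act ctrl) :=
  ⟨fun _ => inferInstanceAs (IsProbabilityMeasure (Kernel.trajMeasure _ _))⟩

/-- The kernel sending a state `s` to the sub-probability law of the next state on the event that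
the next observation is `z`, when action `b` is taken. -/
def envStep [MeasurableSingletonClass Z] (Ptr : Kernel (S × B) (S × Z)) (z : Z) (b : B) :
    Kernel S S :=
  ((Ptr.comap (fun s => (s, b)) (by fun_prop)).restrict
    (s := Set.univ ×ˢ {z}) (MeasurableSet.univ.prod (measurableSet_singleton z))).map Prod.fst

theorem envStep_apply [MeasurableSingletonClass Z] (Ptr : Kernel (S × B) (S × Z)) (z : Z) (b : B)
    (s : S) {T : Set S} (hT : MeasurableSet T) :
    envStep Ptr z b s T = Ptr (s, b) (T ×ˢ {z}) := by
  rw [envStep, Kernel.map_apply' _ measurable_fst _ hT, Kernel.restrict_apply',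
    Kernel.comap_apply]
  · congr 1; ext x; simp
  · exact measurable_fst hT

/-- The contribution of the environment to the probability that the observations `z` and the
actions `b` occur up to time `t`, as a measure in the state at time `t`. -/
def envMeasure [MeasurableSingletonClass Z] (P₁ : Measure (S × Z)) (Ptr : Kernel (S × B) (S × Z))
    (z : ℕ → Z) (b : ℕ → B) : ℕ → Measure S
  | 0 => (P₁.restrict (Set.univ ×ˢ {z 0})).map Prod.fst
  | t + 1 => (envMeasure P₁ Ptr z b t).bind (envStep Ptr (z (t + 1)) (b t))

theorem envMeasure_zero_apply [MeasurableSingletonClass Z] (P₁ : Measure (S × Z))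
    (Ptr : Kernel (S × B) (S × Z)) (z : ℕ → Z) (b : ℕ → B) {T : Set S} (hT : MeasurableSet T) :
    envMeasure P₁ Ptr z b 0 T = P₁ (T ×ˢ {z 0}) := by
  rw [envMeasure, Measure.map_apply measurable_fst hT, Measure.restrict_apply (measurable_fst hT)]
  congr 1; ext x; simp

theorem envMeasure_succ_apply [MeasurableSingletonClass Z] (P₁ : Measure (S × Z))
    (Ptr : Kernel (S × B) (S × Z)) (z : ℕ → Z) (b : ℕ → B) (t : ℕ) {T : Set S}
    (hT : MeasurableSet T) :
    envMeasure P₁ Ptr z b (t + 1) T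
      = ∫⁻ s, Ptr (s, b t) (T ×ˢ {z (t + 1)}) ∂envMeasure P₁ Ptr z b t := by
  rw [envMeasure, Measure.bind_apply hT (Kernel.aemeasurable _)]
  simp_rw [envStep_apply _ _ _ _ hT]

theorem measurableSet_pathEvent [MeasurableSingletonClass Z] (z : ℕ → Z) (G : ∀ s, Set (D s))
    (t : ℕ) : MeasurableSet (pathEvent (S := S) z G t) := by
  simp only [pathEvent, Set.ofPred_forall]
  refine MeasurableSet.iInter fun s => MeasurableSet.iInter fun _ => ?_
  refine MeasurableSet.inter (s₁ := {ω : ∀ t, Stage S Z D t | (ω s).1.2 = z s})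
    (s₂ := {ω : ∀ t, Stage S Z D t | (ω s).2 ∈ G s}) ?_ ?_
  · exact (by fun_prop : Measurable fun ω : ∀ t, Stage S Z D t => (ω s).1.2)
      (measurableSet_singleton (z s))
  · exact (by fun_prop : Measurable fun ω : ∀ t, Stage S Z D t => (ω s).2)
      (MeasurableSet.of_discrete (s := G s))

theorem initialKernel_apply_prod [MeasurableSingletonClass Z] (P₁ : Measure (S × Z))
    [IsProbabilityMeasure P₁]
    (ctrl : ∀ t, Kernel (P × History Z D t) (D t)) [∀ t, IsMarkovKernel (ctrl t)]
    (p : P) {T : Set S} (hT : MeasurableSet T) (z : Z) (G : Set (D 0)) (c : ℝ≥0∞)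
    (hc : ctrl 0 (p, firstHistory z) G = c) :
    initialKernel P₁ ctrl p ((T ×ˢ {z}) ×ˢ G) = c * P₁ (T ×ˢ {z}) := by
  have hTz : MeasurableSet (T ×ˢ {z}) := hT.prod (measurableSet_singleton z)
  rw [initialKernel, Kernel.compProd_apply_prod hTz .of_discrete, Kernel.const_apply,
    setLIntegral_congr_fun (g := fun _ => c) hTz, setLIntegral_const]
  rintro ⟨s, z'⟩ ⟨-, hz⟩
  obtain rfl : z' = z := hz
  simpa [Kernel.comap_apply] using hc

theorem stepKernel_apply_prod [MeasurableSingletonClass Z] (Ptr : Kernel (S × B) (S × Z))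
    [IsMarkovKernel Ptr] (act : ∀ t, D t → B)
    (ctrl : ∀ t, Kernel (P × History Z D t) (D t)) [∀ t, IsMarkovKernel (ctrl t)] (t : ℕ)
    (p : P) (x : ∀ i : Iic t, Stage S Z D i) {T : Set S} (hT : MeasurableSet T) (z : Z)
    (G : Set (D (t + 1))) (c : ℝ≥0∞) (hc : ctrl (t + 1) (p, nextHistory t x z) G = c) :
    stepKernel Ptr act ctrl t (p, x) ((T ×ˢ {z}) ×ˢ G)
      = c * Ptr ((x ⟨t, mem_Iic.2 le_rfl⟩).1.1, act t (x ⟨t, mem_Iic.2 le_rfl⟩).2)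
          (T ×ˢ {z}) := by
  have hTz : MeasurableSet (T ×ˢ {z}) := hT.prod (measurableSet_singleton z)
  rw [stepKernel, Kernel.compProd_apply_prod hTz .of_discrete, Kernel.comap_apply,
    setLIntegral_congr_fun (g := fun _ => c) hTz, setLIntegral_const]
  rintro ⟨s, z'⟩ ⟨-, hz⟩
  obtain rfl : z' = z := hz
  simpa [Kernel.comap_apply] using hc

/-- If the probability `c s` of deciding within `G s` is the same for all histories compatible with
the observations `z` and with the sets `G`, then the probability of a path event is the product of
the `c s` and of a factor depending on the environment only. -/
theorem trajLaw_pathEvent_inter_state [MeasurableSingletonClass Z] (P₁ : Measure (S × Z))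
    [IsProbabilityMeasure P₁]
    (Ptr : Kernel (S × B) (S × Z)) [IsMarkovKernel Ptr] (act : ∀ t, D t → B)
    (ctrl : ∀ t, Kernel (P × History Z D t) (D t)) [∀ t, IsMarkovKernel (ctrl t)]
    (p : P) (z : ℕ → Z) (b : ℕ → B) (G : ∀ s, Set (D s)) (c : ℕ → ℝ≥0∞)
    (hG : ∀ s, ∀ d ∈ G s, act s d = b s)
    (hc : ∀ s (x : History Z D s), (∀ i, x.1 i = z i) → (∀ i : Fin s, x.2 i ∈ G i) →
      ctrl s (p, x) (G s) = c s) (t : ℕ) {T : Set S} (hT : MeasurableSet T) :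
    trajLaw P₁ Ptr act ctrl p (pathEvent z G t ∩ {ω | (ω t).1.1 ∈ T})
      = (∏ s ∈ range (t + 1), c s) * envMeasure P₁ Ptr z b t T := by
  -- The next transition depends on the current state, so the induction must carry the law of that
  -- state on the path event, not only the probability of the event.
  induction t generalizing T with
  | zero =>
    have h0 : (trajLaw P₁ Ptr act ctrl p).map (fun ω => ω 0) = initialKernel P₁ ctrl p := by
      change (Kernel.trajMeasure (initialKernel P₁ ctrl p)
        fun t => (stepKernel Ptr act ctrl t).sectR p).map _ = _
      let e := MeasurableEquiv.piUnique fun i : Iic 0 => Stage S Z D i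
      have h : (Kernel.trajMeasure (initialKernel P₁ ctrl p)
          fun t => (stepKernel Ptr act ctrl t).sectR p).map (frestrictLe 0)
          = (initialKernel P₁ ctrl p).map e.symm := by
        rw [Kernel.trajMeasure, Measure.map_comp _ _ (by fun_prop),
          Kernel.traj_map_frestrictLe, Kernel.partialTraj_self, Measure.id_comp]
      exact (Measure.map_map e.measurable (by fun_prop)).symm.trans
        ((congrArg (Measure.map e) h).trans e.map_map_symm)
    have hev : pathEvent (S := S) z G 0 ∩ {ω | (ω 0).1.1 ∈ T}
        = (fun ω => ω 0) ⁻¹' ((T ×ˢ {z 0}) ×ˢ G 0) := by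
      ext ω; simp [pathEvent]; tauto
    rw [hev, ← Measure.map_apply (by fun_prop)
      ((hT.prod (measurableSet_singleton _)).prod .of_discrete), h0,
      initialKernel_apply_prod P₁ ctrl p hT (z 0) (G 0) (c 0), envMeasure_zero_apply _ _ _ _ hT]
    · simp
    · refine hc 0 _ (fun i => ?_) (fun i => i.elim0)
      obtain rfl : i = (0 : Fin 1) := Subsingleton.elim (α := Fin 1) _ _
      rfl
  | succ t ih =>
    set law := trajLaw P₁ Ptr act ctrl p
    -- The induction hypothesis for all `T` at once is an identity of measures, against which the
    -- transition probability can be integrated.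
    have hlawt : (law.restrict (pathEvent z G t)).map (fun ω => (ω t).1.1)
        = (∏ s ∈ range (t + 1), c s) • envMeasure P₁ Ptr z b t := by
      ext T' hT'
      have hm : Measurable fun ω : ∀ t, Stage S Z D t => (ω t).1.1 := by fun_prop
      rw [Measure.map_apply hm hT', Measure.restrict_apply (hm hT'), Set.inter_comm,
        Measure.smul_apply, smul_eq_mul, ← ih hT']
      rfl
    -- The path event up to `t`, seen in the space of initial segments, where the one-step
    -- disintegration `hstep` takes place.
    let E : Set (∀ i : Iic t, Stage S Z D i) :=
      {x | ∀ s : Iic t, (x s).1.2 = z s ∧ (x s).2 ∈ G s}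
    have hE : MeasurableSet E := by
      simp only [E, Set.ofPred_forall]
      refine MeasurableSet.iInter fun s => ?_
      refine MeasurableSet.inter (s₁ := {x : ∀ i : Iic t, Stage S Z D i | (x s).1.2 = z s})
        (s₂ := {x : ∀ i : Iic t, Stage S Z D i | (x s).2 ∈ G s}) ?_ ?_
      · exact (by fun_prop : Measurable fun x : ∀ i : Iic t, Stage S Z D i => (x s).1.2)
          (measurableSet_singleton (z s))
      · exact (by fun_prop : Measurable fun x : ∀ i : Iic t, Stage S Z D i => (x s).2)
          (MeasurableSet.of_discrete (s := G s))
    have hpre : (frestrictLe t) ⁻¹' E = pathEvent (S := S) z G t := by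
      ext ω; simp [E, pathEvent]
    have hev : pathEvent (S := S) z G (t + 1) ∩ {ω | (ω (t + 1)).1.1 ∈ T}
        = (fun ω => (frestrictLe (π := Stage S Z D) t ω, ω (t + 1))) ⁻¹'
          (E ×ˢ ((T ×ˢ {z (t + 1)}) ×ˢ G (t + 1))) := by
      ext ω
      have : ω ∈ pathEvent (S := S) z G (t + 1) ↔ ω ∈ pathEvent (S := S) z G t ∧
          ((ω (t + 1)).1.2 = z (t + 1) ∧ (ω (t + 1)).2 ∈ G (t + 1)) := by
        simp only [pathEvent, Set.mem_ofPred_eq, Nat.le_succ_iff]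
        exact ⟨fun h => ⟨fun s hs => h s (.inl hs), h _ (.inr rfl)⟩,
          fun h s hs => hs.elim (h.1 s) (by rintro rfl; exact h.2)⟩
      rw [Set.mem_inter_iff, this, ← hpre]
      simp only [Set.mem_preimage, Set.mem_prod, Set.mem_singleton_iff, Set.mem_ofPred_eq]
      tauto
    have hTz : MeasurableSet (T ×ˢ {z (t + 1)}) := hT.prod (measurableSet_singleton _)
    have hstep := Kernel.map_frestrictLe_trajMeasure_compProd_eq_map_trajMeasure
      (μ₀ := initialKernel P₁ ctrl p) (κ := fun t => (stepKernel Ptr act ctrl t).sectR p) (a := t)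
    change (law.map (frestrictLe t)) ⊗ₘ ((stepKernel Ptr act ctrl t).sectR p)
      = law.map (fun ω => (frestrictLe t ω, ω (t + 1))) at hstep
    -- On the path event `hc` makes the decision probability constant and `hG` fixes the last
    -- action, so the integrand depends on `ω` only through the state at time `t`.
    have hval : ∀ ω ∈ pathEvent (S := S) z G t,
        (stepKernel Ptr act ctrl t).sectR p (frestrictLe t ω)
          ((T ×ˢ {z (t + 1)}) ×ˢ G (t + 1))
          = c (t + 1) * Ptr ((ω t).1.1, b t) (T ×ˢ {z (t + 1)}) := by
      intro ω hω
      rw [Kernel.sectR_apply, stepKernel_apply_prod Ptr act ctrl t p _ hT _ _ (c (t + 1))]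
      · rw [← hG t _ (hω t le_rfl).2]; rfl
      · refine hc (t + 1) _ (fun i => ?_) (fun i => ?_)
        · induction i using Fin.lastCases with
          | last => simp [nextHistory]
          | cast i => simpa [nextHistory] using (hω i (Nat.le_of_lt_succ i.2)).1
        · exact (hω i (Nat.le_of_lt_succ i.2)).2
    have hPm : Measurable fun s => Ptr (s, b t) (T ×ˢ {z (t + 1)}) :=
      (Ptr.measurable_coe hTz).comp (by fun_prop)
    rw [hev, ← Measure.map_apply (by fun_prop) (hE.prod (hTz.prod .of_discrete)), ← hstep,
      Measure.compProd_apply_prod hE (hTz.prod .of_discrete),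
      setLIntegral_map hE (Kernel.measurable_coe _ (hTz.prod .of_discrete)) (by fun_prop), hpre,
      setLIntegral_congr_fun (measurableSet_pathEvent z G t) hval,
      lintegral_const_mul _ (show Measurable fun ω : ∀ t, Stage S Z D t =>
        Ptr ((ω t).1.1, b t) (T ×ˢ {z (t + 1)}) from hPm.comp (by fun_prop)),
      ← lintegral_map (μ := law.restrict (pathEvent z G t)) (g := fun ω => (ω t).1.1) hPm
        (by fun_prop), hlawt,
      lintegral_smul_measure, ← envMeasure_succ_apply P₁ Ptr z b t hT, prod_range_succ _ (t + 1),
      smul_eq_mul]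
    ring

theorem trajLaw_pathEvent [MeasurableSingletonClass Z] (P₁ : Measure (S × Z))
    [IsProbabilityMeasure P₁]
    (Ptr : Kernel (S × B) (S × Z)) [IsMarkovKernel Ptr] (act : ∀ t, D t → B)
    (ctrl : ∀ t, Kernel (P × History Z D t) (D t)) [∀ t, IsMarkovKernel (ctrl t)]
    (p : P) (z : ℕ → Z) (b : ℕ → B) (G : ∀ s, Set (D s)) (c : ℕ → ℝ≥0∞)
    (hG : ∀ s, ∀ d ∈ G s, act s d = b s)
    (hc : ∀ s (x : History Z D s), (∀ i, x.1 i = z i) → (∀ i : Fin s, x.2 i ∈ G i) →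
      ctrl s (p, x) (G s) = c s) (t : ℕ) :
    trajLaw P₁ Ptr act ctrl p (pathEvent z G t)
      = (∏ s ∈ range (t + 1), c s) * envMeasure P₁ Ptr z b t Set.univ := by
  rw [← trajLaw_pathEvent_inter_state P₁ Ptr act ctrl p z b G c hG hc t .univ]
  simp

end Factorization

/-! ### Occupation measures of mixtures as integrals. -/

section Mixtures

variable {S Z B P : Type*} {D : ℕ → Type*} [MeasurableSpace S] [MeasurableSpace Z]
  [MeasurableSpace P] [∀ t, MeasurableSpace (D t)] [∀ t, DiscreteMeasurableSpace (D t)]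

theorem mixtureOccupation_eq_lintegral [MeasurableSingletonClass Z] (act : ∀ t, D t → B)
    (law : Kernel P (∀ t, Stage S Z D t)) [IsMarkovKernel law] (μ : ProbabilityMeasure P) :
    mixtureOccupation act law μ = fun t h a => ∫⁻ p, occupation act (law p) t h a ∂μ := by
  ext t h a
  obtain ⟨z, b, rfl, rfl⟩ := exists_eq_prefix t h a
  rw [mixtureOccupation, occupation_prefix, mixtureLaw]
  change (Measure.snd _) _ = _
  rw [Measure.snd_compProd, Measure.bind_apply (measurableSet_pathEvent _ _ _)
    law.aemeasurable]
  simp_rw [occupation_prefix]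

theorem mixtureOccupation_map {Q : Type*} [MeasurableSpace Q] [MeasurableSingletonClass Z]
    (act : ∀ t, D t → B) (law : Kernel P (∀ t, Stage S Z D t)) [IsMarkovKernel law] {f : Q → P}
    (hf : Measurable f) (μ : ProbabilityMeasure Q) :
    mixtureOccupation act law (μ.map hf.aemeasurable)
      = fun t h a => ∫⁻ q, occupation act (law (f q)) t h a ∂μ := by
  rw [mixtureOccupation_eq_lintegral]
  ext t x a
  obtain ⟨z, b, rfl, rfl⟩ := exists_eq_prefix t x a
  simp_rw [occupation_prefix]
  exact lintegral_map (law.measurable_coe (measurableSet_pathEvent _ _ _)) hf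

/-- The point mass at a policy has the same occupation measure as the policy. -/
theorem mixtureOccupation_dirac [MeasurableSingletonClass Z] (act : ∀ t, D t → B)
    (law : Kernel P (∀ t, Stage S Z D t)) [IsMarkovKernel law] (p : P) :
    mixtureOccupation act law (diracProba p) = occupation act (law p) := by
  rw [mixtureOccupation_eq_lintegral]
  ext t x a
  obtain ⟨z, b, rfl, rfl⟩ := exists_eq_prefix t x a
  simp_rw [occupation_prefix]
  exact lintegral_dirac' p (law.measurable_coe (measurableSet_pathEvent _ _ _))

theorem measurable_measure_of_singleton {X : Type*} [MeasurableSpace X] [Countable X]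
    [MeasurableSingletonClass X] {f : P → Measure X} (h : ∀ x, Measurable fun p => f p {x}) :
    Measurable f := by
  refine Measure.measurable_of_measurable_coe _ fun s _ => ?_
  have hs : ∀ p, f p s = ∑' x : s, f p {(x : X)} := fun p => by
    have h := measure_biUnion (μ := f p) (f := fun a => {a}) s.to_countable
      (fun a _ b _ hab => by simpa using hab) fun _ _ => measurableSet_singleton _
    rwa [Set.biUnion_of_singleton] at h
  simp_rw [hs]
  exact Measurable.tsum fun x => h x

end Mixtures

/-! ### Path probabilities in the two team models; decentralized profiles as coordination policies.
-/

section TeamOccupation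

variable {N : ℕ} {O₀ : Type*} {O A : Fin N → Type*}
  [Finite O₀] [∀ n, Finite (O n)] [∀ n, Finite (A n)]
  [MeasurableSpace O₀] [∀ n, MeasurableSpace (O n)] [∀ n, MeasurableSpace (A n)]
  [MeasurableSingletonClass O₀] [∀ n, MeasurableSingletonClass (O n)]
  [∀ n, MeasurableSingletonClass (A n)]
  {S : Type*} [MeasurableSpace S]

/-- Private histories at time `t` along infinite sequences of observations and actions. -/
def privateHistAt {N : ℕ} {O₀ : Type*} {O A : Fin N → Type*} (z : ℕ → JointObs O₀ O)
    (b : ℕ → JointAct A) (t : ℕ) (n : Fin N) : PrivateHist O A n t :=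
  privateHist (fun i => z i) (fun i : Fin t => b i) n

/-- Common histories at time `t` along an infinite sequence of observations. -/
def commonHistAt {N : ℕ} {O₀ : Type*} {O : Fin N → Type*} (z : ℕ → JointObs O₀ O) (t : ℕ) :
    CommonHist O₀ t := fun i => (z i).1

/-- Histories of the coordinator at time `t` along infinite sequences of common observations and
prescriptions. -/
def coordHistAt {N : ℕ} {O₀ : Type*} {O A : Fin N → Type*} (k : ℕ → O₀)
    (γ : ∀ s, Prescription O A s) (t : ℕ) : CoordHist O₀ O A t :=
  (fun i => k i, fun i => γ i)

instance (P₁ : Measure (S × JointObs O₀ O)) [IsProbabilityMeasure P₁]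
    (Ptr : Kernel (S × JointAct A) (S × JointObs O₀ O)) [IsMarkovKernel Ptr] :
    IsMarkovKernel (decLaw P₁ Ptr) := by
  unfold decLaw; infer_instance

instance (P₁ : Measure (S × JointObs O₀ O)) [IsProbabilityMeasure P₁]
    (Ptr : Kernel (S × JointAct A) (S × JointObs O₀ O)) [IsMarkovKernel Ptr] :
    IsMarkovKernel (coordLaw P₁ Ptr) := by
  unfold coordLaw; infer_instance

variable (P₁ : Measure (S × JointObs O₀ O)) [IsProbabilityMeasure P₁]
  (Ptr : Kernel (S × JointAct A) (S × JointObs O₀ O)) [IsMarkovKernel Ptr]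

theorem decLaw_pathEvent (u : DecPolicy O₀ O A) (z : ℕ → JointObs O₀ O) (b : ℕ → JointAct A)
    (t : ℕ) :
    decLaw P₁ Ptr u (pathEvent z (fun s => decAct A s ⁻¹' {b s}) t)
      = (∏ s ∈ range (t + 1),
          ∏ n, (u n s (commonHistAt z s, privateHistAt z b s n) : Measure (A n)) {b s n})
        * envMeasure P₁ Ptr z b t Set.univ := by
  refine trajLaw_pathEvent P₁ Ptr (decAct A) (decControl O₀ O A) u z b _ _
    (fun s d hd => hd) (fun s x hx₁ hx₂ => ?_) t
  obtain ⟨x₁, x₂⟩ := x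
  obtain rfl : x₁ = fun i : Fin (s + 1) => z i := funext (fun i : Fin (s + 1) => hx₁ i)
  obtain rfl : x₂ = fun i : Fin s => b i := funext hx₂
  exact Measure.pi_singleton _ _

theorem coordControl_apply (v : CoordPolicy O₀ O A) (t : ℕ)
    (x : History (JointObs O₀ O) (CoordDecision O A) t) (G : Set (CoordDecision O A t)) :
    coordControl O₀ O A t (v, x) G
      = (v t (commonHist x.1, fun i => (x.2 i).1) : Measure (Prescription O A t))
        {γ | (γ, fun n => γ n (privateHist x.1 (fun i => (x.2 i).2) n)) ∈ G} :=
  Measure.map_apply (measurable_of_finite _) .of_discrete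

/-- Fixing prescriptions as well as actions determines the coordinator's whole history, so the
factorization applies to an arbitrary `v`. Only the first product involves `v`; the indicators
merely check that `γ` produces `b`. -/
theorem coordLaw_pathEvent_singleton (v : CoordPolicy O₀ O A) (z : ℕ → JointObs O₀ O)
    (b : ℕ → JointAct A) (γ : ∀ s, Prescription O A s) (t : ℕ) :
    coordLaw P₁ Ptr v (pathEvent z (fun s => {(γ s, b s)}) t)
      = (∏ s ∈ range (t + 1),
          (v s (coordHistAt (fun i => (z i).1) γ s) : Measure (Prescription O A s)) {γ s})
        * ((∏ s ∈ range (t + 1),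
            Set.indicator {γ' | (fun n => γ' n (privateHistAt z b s n)) = b s} 1 (γ s))
          * envMeasure P₁ Ptr z b t Set.univ) := by
  rw [← mul_assoc, ← prod_mul_distrib]
  refine trajLaw_pathEvent P₁ Ptr (coordAct O A) (coordControl O₀ O A) v z b
    (fun s => {(γ s, b s)}) _ (fun s d hd => congrArg Prod.snd hd) (fun s x hx₁ hx₂ => ?_) t
  obtain ⟨x₁, x₂⟩ := x
  obtain rfl : x₁ = fun i : Fin (s + 1) => z i := funext (fun i : Fin (s + 1) => hx₁ i)
  obtain rfl : x₂ = fun i : Fin s => (γ i, b i) := funext hx₂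
  rw [coordControl_apply]
  change (v s (coordHistAt (fun i => (z i).1) γ s) : Measure (Prescription O A s))
    {γ' | (γ', fun n => γ' n (privateHistAt z b s n)) ∈ _} = _
  by_cases h : (fun n => γ s n (privateHistAt z b s n)) = b s
  · rw [Set.indicator_of_mem (by exact h), Pi.one_apply, mul_one]
    congr 1
    ext γ'
    simp only [Set.mem_ofPred_eq, Set.mem_singleton_iff, Prod.mk.injEq]
    exact ⟨fun h => h.1, fun h' => ⟨h', h' ▸ h⟩⟩
  · rw [Set.indicator_of_notMem (by exact h), mul_zero]
    refine (congrArg _ ?_).trans measure_empty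
    ext γ'
    simp only [Set.mem_ofPred_eq, Set.mem_singleton_iff, Prod.mk.injEq, Set.mem_empty_iff_false,
      iff_false, not_and]
    rintro rfl
    exact h

/-! ### Decentralized policies as coordination policies -/

omit [∀ n, MeasurableSingletonClass (A n)] in
/-- The coordination policy which draws the actions of all agents for all private histories
independently from a decentralized policy-profile. -/
def coordOfDec (u : DecPolicy O₀ O A) : CoordPolicy O₀ O A := fun t h =>
  ⟨Measure.pi fun n => Measure.infinitePi fun x => (u n t (h.1, x) : Measure (A n)),
    inferInstance⟩

-- Private histories are finite in number, so the mass of a single prescription is a finite product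
-- of evaluations of `u`.
omit [Finite O₀] [MeasurableSpace O₀] [MeasurableSingletonClass O₀] [∀ n, MeasurableSpace (O n)]
  [∀ n, MeasurableSingletonClass (O n)] in
theorem measurable_coordOfDec :
    Measurable (coordOfDec : DecPolicy O₀ O A → CoordPolicy O₀ O A) := by
  refine measurable_pi_lambda _ fun t => measurable_pi_lambda _ fun h => Measurable.subtype_mk ?_
  refine measurable_measure_of_singleton fun γ => ?_
  have : ∀ n, Fintype (PrivateHist O A n t) := fun n => Fintype.ofFinite _
  simp_rw [Measure.pi_singleton, Measure.infinitePi_singleton_of_fintype]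
  refine Finset.measurable_prod _ fun n _ => Finset.measurable_prod _ fun x _ => ?_
  exact (Measure.measurable_coe (measurableSet_singleton _)).comp
    (measurable_subtype_coe.comp (by fun_prop))

/-- Past prescriptions are not fixed by the event here, but `coordOfDec u` ignores them, so the
probability of producing `b s` is still constant. It is the marginal of a product measure at the
private histories actually reached, hence the same product over agents as in the decentralized
model. -/
theorem occupation_coordOfDec (u : DecPolicy O₀ O A) :
    occupation (coordAct O A) (coordLaw P₁ Ptr (coordOfDec u))
      = occupation (decAct A) (decLaw P₁ Ptr u) := by
  ext t h a
  obtain ⟨z, b, rfl, rfl⟩ := exists_eq_prefix t h a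
  rw [occupation_prefix, occupation_prefix, decLaw_pathEvent]
  refine trajLaw_pathEvent P₁ Ptr (coordAct O A) (coordControl O₀ O A) _ z b
    (fun s => coordAct O A s ⁻¹' {b s}) _ (fun s d hd => hd) (fun s x hx₁ hx₂ => ?_) t
  obtain ⟨x₁, x₂⟩ := x
  obtain rfl : x₁ = fun i : Fin (s + 1) => z i := funext (fun i : Fin (s + 1) => hx₁ i)
  have hb : (fun i : Fin s => (x₂ i).2) = fun i : Fin s => b i := funext hx₂
  rw [coordControl_apply, hb]
  change Measure.pi (fun n => Measure.infinitePi fun x : PrivateHist O A n s =>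
    (u n s (commonHistAt z s, x) : Measure (A n)))
    {γ | (fun n => γ n (privateHistAt z b s n)) = b s} = _
  have hset : {γ : Prescription O A s | (fun n => γ n (privateHistAt z b s n)) = b s}
      = Set.univ.pi fun n =>
        (fun f : PrivateHist O A n s → A n => f (privateHistAt z b s n)) ⁻¹' {b s n} := by
    ext γ
    simp [funext_iff]
  rw [hset, Measure.pi_pi]
  refine prod_congr rfl fun n _ => ?_
  exact (measurePreserving_eval_infinitePi _ _).measure_preimage
    (measurableSet_singleton _).nullMeasurableSet

end TeamOccupation

/-! ### Kuhn-type equivalence for the coordinator. -/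

section CoordMixtures

variable {N : ℕ} {O₀ : Type*} {O A : Fin N → Type*}
  [Finite O₀] [∀ n, Finite (O n)] [∀ n, Finite (A n)]
  [MeasurableSpace O₀] [∀ n, MeasurableSpace (O n)] [∀ n, MeasurableSpace (A n)]
  [MeasurableSingletonClass O₀] [∀ n, MeasurableSingletonClass (O n)]
  [∀ n, MeasurableSingletonClass (A n)]
  {S : Type*} [MeasurableSpace S]
  (P₁ : Measure (S × JointObs O₀ O)) [IsProbabilityMeasure P₁]
  (Ptr : Kernel (S × JointAct A) (S × JointObs O₀ O)) [IsMarkovKernel Ptr]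

/-- Extension of finitely many prescriptions by constant ones. -/
def extendPrescriptions {N : ℕ} {O A : Fin N → Type*} (a : JointAct A) {t : ℕ}
    (γ : ∀ i : Fin (t + 1), Prescription O A i) (s : ℕ) : Prescription O A s :=
  if h : s < t + 1 then γ ⟨s, h⟩ else fun n _ => a n

/-- The prescriptions up to time `t` partition the event. The values of the extension after time `t`
are irrelevant; `b 0` only supplies an inhabitant. -/
theorem coordLaw_pathEvent_eq_tsum (v : CoordPolicy O₀ O A) (z : ℕ → JointObs O₀ O)
    (b : ℕ → JointAct A) (t : ℕ) :
    coordLaw P₁ Ptr v (pathEvent z (fun s => coordAct O A s ⁻¹' {b s}) t)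
      = ∑' γ : ∀ i : Fin (t + 1), Prescription O A i,
        coordLaw P₁ Ptr v (pathEvent z (fun s => {(extendPrescriptions (b 0) γ s, b s)}) t) := by
  rw [← measure_iUnion _ fun γ => measurableSet_pathEvent _ _ _]
  · congr 1
    ext ω
    simp only [pathEvent, Set.mem_ofPred_eq, Set.mem_iUnion, Set.mem_preimage,
      Set.mem_singleton_iff]
    constructor
    · intro h
      refine ⟨fun i => (ω i).2.1, fun s hs => ⟨(h s hs).1, Prod.ext ?_ (h s hs).2⟩⟩
      rw [extendPrescriptions, dif_pos (Nat.lt_succ_of_le hs)]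
    · rintro ⟨γ, h⟩ s hs
      exact ⟨(h s hs).1, congrArg Prod.snd (h s hs).2⟩
  · intro γ γ' hne
    refine Set.disjoint_left.2 fun ω h h' => hne (funext fun i => ?_)
    have h1 := (h i (Nat.le_of_lt_succ i.2)).2.symm.trans (h' i (Nat.le_of_lt_succ i.2)).2
    simpa [extendPrescriptions, i.2] using congrArg Prod.fst h1

/-- The probability that a coordination policy draws the prescriptions `γ` before time `t` when the
common observations are `k`. -/
def drawProb {N : ℕ} {O₀ : Type*} {O A : Fin N → Type*} [∀ n, MeasurableSpace (A n)]
    (k : ℕ → O₀) (γ : ∀ s, Prescription O A s) (t : ℕ) (v : CoordPolicy O₀ O A) : ℝ≥0∞ :=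
  ∏ s ∈ range t, (v s (coordHistAt k γ s) : Measure (Prescription O A s)) {γ s}

omit [Finite O₀] [MeasurableSpace O₀] [MeasurableSingletonClass O₀] [∀ n, MeasurableSpace (O n)]
  [∀ n, MeasurableSingletonClass (O n)] in
theorem measurable_drawProb (k : ℕ → O₀) (γ : ∀ s, Prescription O A s) (t : ℕ) :
    Measurable (drawProb k γ t : CoordPolicy O₀ O A → ℝ≥0∞) := by
  refine Finset.measurable_prod _ fun s _ => ?_
  exact (Measure.measurable_coe (measurableSet_singleton _)).comp
    (measurable_subtype_coe.comp (by fun_prop))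

/-- Mixtures of coordination policies which draw all sequences of prescriptions with the same
probabilities have the same occupation measure. -/
theorem mixtureOccupation_coord_congr {ν ν' : ProbabilityMeasure (CoordPolicy O₀ O A)}
    (h : ∀ k γ t, ∫⁻ v, drawProb k γ t v ∂(ν : Measure (CoordPolicy O₀ O A))
      = ∫⁻ v, drawProb k γ t v ∂(ν' : Measure (CoordPolicy O₀ O A))) :
    mixtureOccupation (coordAct O A) (coordLaw P₁ Ptr) ν
      = mixtureOccupation (coordAct O A) (coordLaw P₁ Ptr) ν' := by
  rw [mixtureOccupation_eq_lintegral, mixtureOccupation_eq_lintegral]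
  ext t x a
  obtain ⟨z, b, rfl, rfl⟩ := exists_eq_prefix t x a
  simp_rw [occupation_prefix, coordLaw_pathEvent_eq_tsum]
  rw [lintegral_tsum, lintegral_tsum]
  · refine tsum_congr fun γ => ?_
    -- Each summand is now `drawProb` times a constant, so the hypothesis applies term by term.
    simp_rw [coordLaw_pathEvent_singleton]
    have hm := measurable_drawProb (O₀ := O₀) (fun i => (z i).1)
      (extendPrescriptions (b 0) γ) (t + 1)
    exact (lintegral_mul_const _ hm).trans
      ((congrArg (· * _) (h _ _ _)).trans (lintegral_mul_const _ hm).symm)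
  all_goals
    exact fun γ => ((coordLaw P₁ Ptr).measurable_coe (measurableSet_pathEvent _ _ _)).aemeasurable

/-! ### Mixtures of coordination policies as coordination policies -/

/-- The part of a history of the coordinator up to an earlier time. -/
def CoordHist.truncate {N : ℕ} {O₀ : Type*} {O A : Fin N → Type*} {t : ℕ}
    (h : CoordHist O₀ O A t) (i : Fin t) : CoordHist O₀ O A i :=
  (fun j => h.1 ⟨j, by omega⟩, fun j => h.2 ⟨j, by omega⟩)

/-- The probability that a coordination policy draws the prescriptions in a given history. -/
def histProb {N : ℕ} {O₀ : Type*} {O A : Fin N → Type*} [∀ n, MeasurableSpace (A n)] {t : ℕ}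
    (h : CoordHist O₀ O A t) (v : CoordPolicy O₀ O A) : ℝ≥0∞ :=
  ∏ i : Fin t, (v i (CoordHist.truncate h i) : Measure (Prescription O A i)) {h.2 i}

theorem histProb_coordHistAt {N : ℕ} {O₀ : Type*} {O A : Fin N → Type*}
    [∀ n, MeasurableSpace (A n)] (k : ℕ → O₀) (γ : ∀ s, Prescription O A s) (t : ℕ)
    (v : CoordPolicy O₀ O A) : histProb (coordHistAt k γ t) v = drawProb k γ t v :=
  Fin.prod_univ_eq_prod_range
    (fun s => (v s (coordHistAt k γ s) : Measure (Prescription O A s)) {γ s}) t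

/-- The law of the next prescription under a mixture, restricted to the event that the prescriptions
in a given history have been drawn. -/
def nextPrescription (ν : ProbabilityMeasure (CoordPolicy O₀ O A)) {t : ℕ}
    (h : CoordHist O₀ O A t) : Measure (Prescription O A t) :=
  ((ν : Measure (CoordPolicy O₀ O A)).withDensity (histProb h)).bind
    fun v => (v t h : Measure (Prescription O A t))

omit [Finite O₀] [MeasurableSpace O₀] [MeasurableSingletonClass O₀]
  [∀ n, MeasurableSpace (O n)] [∀ n, MeasurableSingletonClass (O n)] in
theorem nextPrescription_apply (ν : ProbabilityMeasure (CoordPolicy O₀ O A)) (k : ℕ → O₀)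
    (γ : ∀ s, Prescription O A s) (t : ℕ) (G : Set (Prescription O A t)) :
    nextPrescription ν (coordHistAt k γ t) G
      = ∫⁻ v, drawProb k γ t v * (v t (coordHistAt k γ t) : Measure (Prescription O A t)) G ∂ν := by
  have hm : Measurable fun v : CoordPolicy O₀ O A =>
      (v t (coordHistAt k γ t) : Measure (Prescription O A t)) :=
    measurable_subtype_coe.comp (by fun_prop)
  have hd : histProb (coordHistAt k γ t) = drawProb (O := O) (A := A) k γ t :=
    funext (histProb_coordHistAt k γ t)
  rw [nextPrescription, Measure.bind_apply .of_discrete hm.aemeasurable, hd]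
  exact lintegral_withDensity_eq_lintegral_mul _ (measurable_drawProb k γ t)
    ((Measure.measurable_coe .of_discrete).comp hm)

omit [Finite O₀] [MeasurableSpace O₀] [MeasurableSingletonClass O₀]
  [∀ n, MeasurableSpace (O n)] [∀ n, MeasurableSingletonClass (O n)] in
theorem nextPrescription_univ (ν : ProbabilityMeasure (CoordPolicy O₀ O A)) (k : ℕ → O₀)
    (γ : ∀ s, Prescription O A s) (t : ℕ) :
    nextPrescription ν (coordHistAt k γ t) Set.univ = ∫⁻ v, drawProb k γ t v ∂ν := by
  rw [nextPrescription_apply]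
  exact lintegral_congr fun v => by rw [measure_univ, mul_one]

-- Together with `nextPrescription_univ`, this exhibits the normalized mass of `γ t` as a ratio of
-- consecutive expectations of `drawProb`, the source of the telescoping below.
omit [Finite O₀] [MeasurableSpace O₀] [MeasurableSingletonClass O₀]
  [∀ n, MeasurableSpace (O n)] [∀ n, MeasurableSingletonClass (O n)] in
theorem nextPrescription_singleton (ν : ProbabilityMeasure (CoordPolicy O₀ O A)) (k : ℕ → O₀)
    (γ : ∀ s, Prescription O A s) (t : ℕ) :
    nextPrescription ν (coordHistAt k γ t) {γ t} = ∫⁻ v, drawProb k γ (t + 1) v ∂ν := by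
  rw [nextPrescription_apply]
  exact lintegral_congr fun v => (prod_range_succ _ _).symm

omit [Finite O₀] [∀ n, Finite (O n)] [∀ n, Finite (A n)] [MeasurableSpace O₀]
  [∀ n, MeasurableSpace (O n)] [MeasurableSingletonClass O₀]
  [∀ n, MeasurableSingletonClass (O n)] [∀ n, MeasurableSingletonClass (A n)] in
theorem lintegral_drawProb_le_one (ν : ProbabilityMeasure (CoordPolicy O₀ O A)) (k : ℕ → O₀)
    (γ : ∀ s, Prescription O A s) (t : ℕ) : ∫⁻ v, drawProb k γ t v ∂ν ≤ 1 := by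
  refine (lintegral_mono (g := fun _ => 1) fun v => ?_).trans_eq
    (lintegral_one.trans measure_univ)
  exact prod_le_one' fun _ _ => prob_le_one

open Classical in
/-- The conditional law of the next prescription under a mixture, given the prescriptions in a
history; for histories of probability zero, an arbitrary law. -/
def condPolicy (ν : ProbabilityMeasure (CoordPolicy O₀ O A)) (v₀ : CoordPolicy O₀ O A) :
    CoordPolicy O₀ O A := fun t h =>
  if H : IsProbabilityMeasure
      ((nextPrescription ν h Set.univ)⁻¹ • nextPrescription ν h) then
    ⟨(nextPrescription ν h Set.univ)⁻¹ • nextPrescription ν h, H⟩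
  else v₀ t h

-- The chain rule: multiplying the probability of the past prescriptions by the conditional
-- probability of the next one gives the probability of the longer sequence.
omit [Finite O₀] [MeasurableSpace O₀] [MeasurableSingletonClass O₀]
  [∀ n, MeasurableSpace (O n)] [∀ n, MeasurableSingletonClass (O n)] in
theorem drawProb_condPolicy (ν : ProbabilityMeasure (CoordPolicy O₀ O A))
    (v₀ : CoordPolicy O₀ O A) (k : ℕ → O₀) (γ : ∀ s, Prescription O A s) (t : ℕ) :
    drawProb k γ t (condPolicy ν v₀) = ∫⁻ v, drawProb k γ t v ∂ν := by
  induction t with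
  | zero => simp [drawProb]
  | succ t ih =>
    have hs : drawProb k γ (t + 1) (condPolicy ν v₀) = drawProb k γ t (condPolicy ν v₀)
        * (condPolicy ν v₀ t (coordHistAt k γ t) : Measure (Prescription O A t)) {γ t} :=
      prod_range_succ _ _
    rw [hs, ih, ← nextPrescription_singleton, ← nextPrescription_univ]
    set M := nextPrescription ν (coordHistAt k γ t)
    have hMtop : M Set.univ ≠ ∞ :=
      ((nextPrescription_univ ν k γ t).trans_le (lintegral_drawProb_le_one ν k γ t)).trans_lt
        ENNReal.one_lt_top |>.ne
    -- On a history of mass zero the value of `condPolicy` is irrelevant, since both sides vanish.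
    by_cases h0 : M Set.univ = 0
    · rw [h0, zero_mul, measure_mono_null (Set.subset_univ _) h0]
    · have H : IsProbabilityMeasure ((M Set.univ)⁻¹ • M) :=
        ⟨ENNReal.inv_mul_cancel h0 hMtop⟩
      have hc : condPolicy ν v₀ t (coordHistAt k γ t) = ⟨(M Set.univ)⁻¹ • M, H⟩ := dif_pos H
      rw [hc]
      change M Set.univ * ((M Set.univ)⁻¹ * M {γ t}) = _
      rw [← mul_assoc, ENNReal.mul_inv_cancel h0 hMtop, one_mul]

theorem occMixCoord_subset_occCoord :
    (occMixCoord P₁ Ptr : Set (OccupationFamily O₀ O A)) ⊆ occCoord P₁ Ptr := by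
  rintro _ ⟨ν, rfl⟩
  -- Action sets are not assumed nonempty; a fallback policy exists because `ν` has mass one.
  obtain ⟨v₀⟩ : Nonempty (CoordPolicy O₀ O A) := (ν : Measure _).nonempty_of_neZero
  refine ⟨condPolicy ν v₀, ?_⟩
  change occupation (coordAct O A) (coordLaw P₁ Ptr (condPolicy ν v₀))
    = mixtureOccupation (coordAct O A) (coordLaw P₁ Ptr) ν
  rw [← mixtureOccupation_dirac]
  refine mixtureOccupation_coord_congr P₁ Ptr fun k γ t => ?_
  rw [← drawProb_condPolicy ν v₀]
  exact lintegral_dirac' _ (measurable_drawProb k γ t)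

/-! ### Coordination policies as mixtures of pure ones -/

/-- Deterministic decision rules of the coordinator. -/
abbrev CoordRule {N : ℕ} (O₀ : Type*) (O A : Fin N → Type*) : Type _ :=
  ∀ t : ℕ, CoordHist O₀ O A t → Prescription O A t

/-- The pure coordination policy with given deterministic decision rules. -/
def CoordRule.toPolicy {N : ℕ} {O₀ : Type*} {O A : Fin N → Type*} [∀ n, MeasurableSpace (A n)]
    (g : CoordRule O₀ O A) : pureCoordPolicies O₀ O A :=
  ⟨fun t h => diracProba (g t h), fun t h => ⟨g t h, rfl⟩⟩

omit [Finite O₀] [∀ n, Finite (O n)] [∀ n, Finite (A n)] [MeasurableSpace O₀]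
  [∀ n, MeasurableSpace (O n)] [MeasurableSingletonClass O₀]
  [∀ n, MeasurableSingletonClass (O n)] [∀ n, MeasurableSingletonClass (A n)] in
theorem measurable_toPolicy :
    Measurable (CoordRule.toPolicy : CoordRule O₀ O A → pureCoordPolicies O₀ O A) := by
  refine Measurable.subtype_mk <| measurable_pi_lambda _ fun t => measurable_pi_lambda _ fun h =>
    Measurable.subtype_mk ?_
  exact Measure.measurable_dirac.comp (by fun_prop)

/-- The law of the deterministic decision rules when all prescriptions for all histories are drawn
independently from a coordination policy. -/
def ruleLaw (v : CoordPolicy O₀ O A) : ProbabilityMeasure (CoordRule O₀ O A) :=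
  ⟨Measure.infinitePi fun t => Measure.infinitePi fun h => (v t h : Measure (Prescription O A t)),
    inferInstance⟩

-- Along fixed `k` and `γ`, time `s` consults the single coordinate of the rule at `coordHistAt k γ
-- s`. Different times consult different, independent coordinates, so the probabilities multiply
-- exactly as under `v`.
omit [Finite O₀] [MeasurableSpace O₀] [MeasurableSingletonClass O₀]
  [∀ n, MeasurableSpace (O n)] [∀ n, MeasurableSingletonClass (O n)] in
theorem lintegral_drawProb_ruleLaw (v : CoordPolicy O₀ O A) (k : ℕ → O₀)
    (γ : ∀ s, Prescription O A s) (t : ℕ) :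
    ∫⁻ g : CoordRule O₀ O A, drawProb k γ t g.toPolicy ∂(ruleLaw v : Measure (CoordRule O₀ O A))
      = drawProb k γ t v := by
  have hset : ∀ s, MeasurableSet ((fun f : CoordHist O₀ O A s → Prescription O A s => f (coordHistAt k γ s)) ⁻¹' {γ s} :
      Set (CoordHist O₀ O A s → Prescription O A s)) := fun s =>
    measurable_pi_apply _ (measurableSet_singleton _)
  classical
  -- For a pure policy `drawProb` takes only the values 0 and 1, and is the indicator of a cylinder
  -- set of rules.
  have h : ∀ g : CoordRule O₀ O A, drawProb k γ t g.toPolicy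
      = Set.indicator (Set.pi (range t) fun s => (fun f : CoordHist O₀ O A s → Prescription O A s => f (coordHistAt k γ s)) ⁻¹' {γ s})
        1 g := by
    intro g
    have hs : ∀ s, ((g.toPolicy : CoordPolicy O₀ O A) s (coordHistAt k γ s) :
        Measure (Prescription O A s)) {γ s} = if g s (coordHistAt k γ s) = γ s then 1 else 0 := by
      intro s
      refine (Measure.dirac_apply _ _).trans ?_
      simp [Set.indicator_apply]
    rw [drawProb, prod_congr rfl fun s _ => hs s, prod_ite_zero, prod_const_one,
      Set.indicator_apply]
    exact if_congr Iff.rfl rfl rfl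
  simp_rw [h]
  rw [lintegral_indicator_one (MeasurableSet.pi (range t).countable_toSet fun s _ => hset s)]
  refine (Measure.infinitePi_pi _ fun s _ => hset s).trans (prod_congr rfl fun s _ => ?_)
  exact (measurePreserving_eval_infinitePi _ _).measure_preimage
    (measurableSet_singleton _).nullMeasurableSet

theorem mixtureOccupation_ruleLaw (v : CoordPolicy O₀ O A) :
    mixtureOccupation (coordAct O A) (coordLaw P₁ Ptr)
      (((ruleLaw v).map measurable_toPolicy.aemeasurable).map
        measurable_subtype_coe.aemeasurable)
      = occupation (coordAct O A) (coordLaw P₁ Ptr v) := by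
  rw [← mixtureOccupation_dirac]
  refine mixtureOccupation_coord_congr P₁ Ptr fun k γ t => ?_
  have hm := measurable_drawProb (O₀ := O₀) k γ t
  refine (lintegral_map hm measurable_subtype_coe).trans ?_
  refine (lintegral_map (hm.comp measurable_subtype_coe) measurable_toPolicy).trans ?_
  exact (lintegral_drawProb_ruleLaw v k γ t).trans (lintegral_dirac' v hm).symm

end CoordMixtures

/-! ### Pure coordination policies as pure decentralized profiles, and the inclusions. -/

section Unfolding

variable {N : ℕ} {O₀ : Type*} {O A : Fin N → Type*}
  [Finite O₀] [∀ n, Finite (O n)] [∀ n, Finite (A n)]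
  [MeasurableSpace O₀] [∀ n, MeasurableSpace (O n)] [∀ n, MeasurableSpace (A n)]
  [MeasurableSingletonClass O₀] [∀ n, MeasurableSingletonClass (O n)]
  [∀ n, MeasurableSingletonClass (A n)]
  {S : Type*} [MeasurableSpace S]
  (P₁ : Measure (S × JointObs O₀ O)) [IsProbabilityMeasure P₁]
  (Ptr : Kernel (S × JointAct A) (S × JointObs O₀ O)) [IsMarkovKernel Ptr]

/-- The prescription which deterministic decision rules of the coordinator select for a given common
history. -/
def CoordRule.unfold {N : ℕ} {O₀ : Type*} {O A : Fin N → Type*} (g : CoordRule O₀ O A) (t : ℕ)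
    (c : CommonHist O₀ t) : Prescription O A t :=
  g t (c, fun i : Fin t => g.unfold i fun j => c ⟨j, by omega⟩)
termination_by t
decreasing_by exact i.2

/-- The pure decentralized policy-profile in which each agent follows the prescriptions selected by
deterministic decision rules of the coordinator. -/
def CoordRule.toDec {N : ℕ} {O₀ : Type*} {O A : Fin N → Type*} [∀ n, MeasurableSpace (A n)]
    (g : CoordRule O₀ O A) : pureDecPolicies O₀ O A :=
  ⟨fun n t h => diracProba (g.unfold t h.1 n h.2), fun n t h => ⟨g.unfold t h.1 n h.2, rfl⟩⟩

omit [Finite O₀] [MeasurableSpace O₀] [∀ n, MeasurableSpace (O n)] [MeasurableSingletonClass O₀]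
  [∀ n, MeasurableSingletonClass (O n)] in
theorem measurable_unfold (t : ℕ) (c : CommonHist O₀ t) :
    Measurable fun g : CoordRule O₀ O A => g.unfold t c := by
  induction t using Nat.strong_induction_on with
  | _ t ih =>
    have hx : Measurable fun g : CoordRule O₀ O A =>
        fun i : Fin t => g.unfold i fun j => c ⟨j, by omega⟩ :=
      measurable_pi_lambda _ fun i => ih i i.2 _
    -- The point at which `g t` is evaluated depends on `g` itself; there are only countably many
    -- such points, so joint measurability reduces to fixed ones.
    have he : Measurable fun q : CoordRule O₀ O A × (∀ i : Fin t, Prescription O A i) =>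
        q.1 t (c, q.2) := measurable_from_prod_countable_left fun x =>
      (measurable_pi_apply (c, x)).comp (measurable_pi_apply t)
    have h := he.comp (measurable_id.prodMk hx)
    convert h using 2 with g
    rw [CoordRule.unfold]
    rfl

omit [Finite O₀] [MeasurableSpace O₀] [∀ n, MeasurableSpace (O n)] [MeasurableSingletonClass O₀]
  [∀ n, MeasurableSingletonClass (O n)] in
theorem measurable_toDec :
    Measurable (CoordRule.toDec : CoordRule O₀ O A → pureDecPolicies O₀ O A) := by
  refine Measurable.subtype_mk <| measurable_pi_lambda _ fun n => measurable_pi_lambda _ fun t =>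
    measurable_pi_lambda _ fun h => Measurable.subtype_mk ?_
  exact Measure.measurable_dirac.comp <| (measurable_pi_apply h.2).comp <|
    (measurable_pi_apply n).comp (measurable_unfold t h.1)

/-- Along the observations `z` the coordinator almost surely issues the prescriptions `γ` unfolded
from the common history. So fixing only the actions differs by a null event from fixing the
prescriptions too, and the latter event has the decentralized probability. -/
theorem occupation_toDec (g : CoordRule O₀ O A) :
    occupation (decAct A) (decLaw P₁ Ptr g.toDec)
      = occupation (coordAct O A) (coordLaw P₁ Ptr g.toPolicy) := by
  ext t h a
  obtain ⟨z, b, rfl, rfl⟩ := exists_eq_prefix t h a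
  rw [occupation_prefix, occupation_prefix, decLaw_pathEvent]
  let γ : ∀ s, Prescription O A s := fun s => g.unfold s (commonHistAt z s)
  have hγ : ∀ s, g s (coordHistAt (fun i => (z i).1) γ s) = γ s := fun s => by
    simp only [γ]
    rw [CoordRule.unfold]
    rfl
  -- The draws of `γ` have probability one, and the indicator that the joint action is `b s` is the
  -- product over agents of Dirac masses.
  have hmain : coordLaw P₁ Ptr g.toPolicy (pathEvent z (fun s => {(γ s, b s)}) t)
      = (∏ s ∈ range (t + 1), ∏ n, ((g.toDec : DecPolicy O₀ O A) n s
          (commonHistAt z s, privateHistAt z b s n) : Measure (A n)) {b s n})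
        * envMeasure P₁ Ptr z b t Set.univ := by
    rw [coordLaw_pathEvent_singleton, ← mul_assoc, ← prod_mul_distrib]
    congr 1
    refine prod_congr rfl fun s _ => ?_
    have h1 : ((g.toPolicy : CoordPolicy O₀ O A) s (coordHistAt (fun i => (z i).1) γ s) :
        Measure (Prescription O A s)) {γ s} = 1 := by
      change Measure.dirac (g s (coordHistAt (fun i => (z i).1) γ s)) {γ s} = 1
      rw [hγ]
      exact Measure.dirac_apply_of_mem rfl
    have h2 : ∀ n, ((g.toDec : DecPolicy O₀ O A) n s
        (commonHistAt z s, privateHistAt z b s n) : Measure (A n)) {b s n}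
        = Set.indicator {b s n} 1 (γ s n (privateHistAt z b s n)) := fun n =>
      Measure.dirac_apply _ _
    simp_rw [h1, h2, one_mul]
    by_cases hb : (fun n => γ s n (privateHistAt z b s n)) = b s
    · rw [Set.indicator_of_mem (by exact hb), Pi.one_apply]
      exact (prod_eq_one fun n _ => Set.indicator_of_mem (s := {b s n}) (congrFun hb n) 1).symm
    · rw [Set.indicator_of_notMem (by exact hb)]
      obtain ⟨n, hn⟩ := Function.ne_iff.1 hb
      exact (prod_eq_zero (mem_univ n)
        (Set.indicator_of_notMem (s := {b s n}) hn 1)).symm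
  rw [← hmain]
  refine measure_eq_measure_of_null_sdiff ?_ ?_
  · exact fun ω hω s hs => ⟨(hω s hs).1, congrArg Prod.snd (hω s hs).2⟩
  -- `G r` describes a first deviation from `γ` at time `r`. It is empty after `r`, which makes the
  -- hypothesis of `trajLaw_pathEvent` hold trivially at the times where the past no longer follows
  -- `γ`.
  let G : ∀ r s, Set (CoordDecision O A s) := fun r s =>
    {d | d.2 = b s ∧ (s < r → d.1 = γ s) ∧ (s = r → d.1 ≠ γ s) ∧ s ≤ r}
  have hnull : ∀ r, coordLaw P₁ Ptr g.toPolicy (pathEvent z (G r) r) = 0 := by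
    intro r
    have hzero : coordControl O₀ O A r ((g.toPolicy : CoordPolicy O₀ O A),
        ((fun i : Fin (r + 1) => z i, fun i : Fin r => (γ i, b i)) :
          History (JointObs O₀ O) (CoordDecision O A) r)) (G r r) = 0 := by
      rw [coordControl_apply]
      change Measure.dirac (g r (coordHistAt (fun i => (z i).1) γ r)) _ = 0
      rw [hγ, Measure.dirac_apply' _ .of_discrete]
      exact Set.indicator_of_notMem (fun h => h.2.2.1 rfl rfl) _
    refine (trajLaw_pathEvent P₁ Ptr (coordAct O A) (coordControl O₀ O A) _ z b (G r)
      (fun s => coordControl O₀ O A s ((g.toPolicy : CoordPolicy O₀ O A),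
        ((fun i : Fin (s + 1) => z i, fun i : Fin s => (γ i, b i)) :
          History (JointObs O₀ O) (CoordDecision O A) s)) (G r s))
      (fun s d hd => hd.1) (fun s x hx₁ hx₂ => ?_) r).trans ?_
    · rcases le_or_gt s r with hsr | hsr
      · obtain ⟨x₁, x₂⟩ := x
        obtain rfl : x₁ = fun i : Fin (s + 1) => z i := funext (fun i : Fin (s + 1) => hx₁ i)
        obtain rfl : x₂ = fun i : Fin s => (γ i, b i) := funext fun i : Fin s =>
          Prod.ext ((hx₂ i).2.1 (i.2.trans_le hsr)) (hx₂ i).1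
        rfl
      · have hempty : G r s = ∅ := Set.eq_empty_of_forall_notMem fun d hd => hsr.not_ge hd.2.2.2
        rw [hempty, measure_empty, measure_empty]
    · rw [prod_eq_zero (self_mem_range_succ r) hzero, zero_mul]
  refine measure_mono_null (t := ⋃ r, pathEvent z (G r) r) ?_ (measure_iUnion_null hnull)
  rintro ω ⟨hω, hω'⟩
  by_contra hcon
  simp only [Set.mem_iUnion, not_exists] at hcon
  -- A trajectory outside all first-deviation events never deviates up to time `t`.
  have key : ∀ s, s ≤ t → (ω s).2.1 = γ s := by
    intro s
    induction s using Nat.strong_induction_on with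
    | _ s ih =>
      intro hs
      by_contra hne
      exact hcon s fun s' hs' => ⟨(hω s' (hs'.trans hs)).1, (hω s' (hs'.trans hs)).2,
        fun hlt => ih s' hlt (hs'.trans hs), fun he => by subst he; exact hne, hs'⟩
  exact hω' fun s hs => ⟨(hω s hs).1, Prod.ext (key s hs) (hω s hs).2⟩

theorem occCoord_subset_occMixPureCoord :
    (occCoord P₁ Ptr : Set (OccupationFamily O₀ O A)) ⊆ occMixPureCoord P₁ Ptr := by
  rintro _ ⟨v, rfl⟩
  exact ⟨_, mixtureOccupation_ruleLaw P₁ Ptr v⟩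

/-- Both mixtures are images of the same law `ruleLaw v` on rules, and `occupation_toDec` identifies
the integrands rule by rule. -/
theorem occCoord_subset_occMixPureDec :
    (occCoord P₁ Ptr : Set (OccupationFamily O₀ O A)) ⊆ occMixPureDec P₁ Ptr := by
  rintro _ ⟨v, rfl⟩
  refine ⟨(ruleLaw v).map measurable_toDec.aemeasurable, ?_⟩
  refine Eq.trans ?_ (mixtureOccupation_ruleLaw P₁ Ptr v)
  have h1 := mixtureOccupation_map (decAct A) (decLaw P₁ Ptr)
    (measurable_subtype_coe.comp (measurable_toDec (O₀ := O₀) (O := O) (A := A))) (ruleLaw v)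
  have h2 := mixtureOccupation_map (coordAct O A) (coordLaw P₁ Ptr)
    (measurable_subtype_coe.comp (measurable_toPolicy (O₀ := O₀) (O := O) (A := A))) (ruleLaw v)
  have e1 : ((ruleLaw v).map (measurable_toDec (O₀ := O₀) (O := O) (A := A)).aemeasurable).map
      measurable_subtype_coe.aemeasurable
      = (ruleLaw v).map (measurable_subtype_coe.comp measurable_toDec).aemeasurable :=
    Subtype.ext (Measure.map_map measurable_subtype_coe measurable_toDec)
  have e2 : ((ruleLaw v).map (measurable_toPolicy (O₀ := O₀) (O := O) (A := A)).aemeasurable).map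
      measurable_subtype_coe.aemeasurable
      = (ruleLaw v).map (measurable_subtype_coe.comp measurable_toPolicy).aemeasurable :=
    Subtype.ext (Measure.map_map measurable_subtype_coe measurable_toPolicy)
  change mixtureOccupation (decAct A) (decLaw P₁ Ptr) (((ruleLaw v).map _).map _) = _
  rw [e1, e2, h1, h2]
  simp only [Function.comp_apply, occupation_toDec]

theorem occMixDec_subset_occMixCoord :
    (occMixDec P₁ Ptr : Set (OccupationFamily O₀ O A)) ⊆ occMixCoord P₁ Ptr := by
  rintro _ ⟨μ, rfl⟩
  refine ⟨μ.map measurable_coordOfDec.aemeasurable, ?_⟩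
  change mixtureOccupation (coordAct O A) (coordLaw P₁ Ptr) _
    = mixtureOccupation (decAct A) (decLaw P₁ Ptr) μ
  rw [mixtureOccupation_map _ _ measurable_coordOfDec, mixtureOccupation_eq_lintegral]
  simp only [occupation_coordOfDec]

theorem occMixPureDec_subset_occMixDec :
    (occMixPureDec P₁ Ptr : Set (OccupationFamily O₀ O A)) ⊆ occMixDec P₁ Ptr := by
  rintro _ ⟨μ, rfl⟩
  exact ⟨_, rfl⟩

theorem occMixPureCoord_subset_occMixCoord :
    (occMixPureCoord P₁ Ptr : Set (OccupationFamily O₀ O A)) ⊆ occMixCoord P₁ Ptr := by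
  rintro _ ⟨μ, rfl⟩
  exact ⟨_, rfl⟩

end Unfolding

end Team

end

theorem mainTheorem1 {N : ℕ} {S O₀ : Type*} {O A : Fin N → Type*}
    [MeasurableSpace S] [MeasurableSpace O₀]
    [∀ n, MeasurableSpace (O n)] [∀ n, MeasurableSpace (A n)]
    [Finite O₀] [∀ n, Finite (O n)] [∀ n, Finite (A n)]
    [MeasurableSingletonClass O₀] [∀ n, MeasurableSingletonClass (O n)]
    [∀ n, MeasurableSingletonClass (A n)]
    (P₁ : Measure (S × Team.JointObs O₀ O)) [IsProbabilityMeasure P₁]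
    (Ptr : Kernel (S × Team.JointAct A) (S × Team.JointObs O₀ O)) [IsMarkovKernel Ptr] :
    Team.occMixPureDec P₁ Ptr = Team.occMixPureCoord P₁ Ptr ∧
    Team.occMixDec P₁ Ptr = Team.occMixPureCoord P₁ Ptr ∧
    Team.occCoord P₁ Ptr = Team.occMixPureCoord P₁ Ptr ∧
    Team.occMixCoord P₁ Ptr = Team.occMixPureCoord P₁ Ptr := by
  -- These six inclusions connect any of the five sets to any other, so every equality comes from
  -- two chains in opposite directions.
  have h1 := Team.occMixPureDec_subset_occMixDec P₁ Ptr
  have h2 := Team.occMixDec_subset_occMixCoord P₁ Ptr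
  have h3 := Team.occMixCoord_subset_occCoord P₁ Ptr
  have h4 := Team.occCoord_subset_occMixPureCoord P₁ Ptr
  have h5 := Team.occCoord_subset_occMixPureDec P₁ Ptr
  have h6 := Team.occMixPureCoord_subset_occMixCoord P₁ Ptr
  have h7 := h3.trans h4
  exact ⟨(h1.trans (h2.trans h7)).antisymm (h6.trans (h3.trans h5)),
    (h2.trans h7).antisymm (h6.trans (h3.trans (h5.trans h1))),
    h4.antisymm (h6.trans h3), h7.antisymm h6⟩
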